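/- Let $n\ge 0$ and let $[\pm n]=\{\pm1,\pm2,\ldots,\pm n\}$. A $B_n$-partition is a partition $\pi$ of $[\pm n]$ into nonempty blocks such that for every block $B$ of $\pi$ the opposite $-B=\{-b: b\in B\}$ is also a block of $\pi$, and at most one block $B$ of $\pi$ satisfies $B=-B$. Order the $B_n$-partitions by refinement ($\pi\le\pi'$ if every block of $\pi$ is contained in some block of $\pi'$), and call $B_n$-partitions $\pi_1,\ldots,\pi_r$ minimally intersecting if their meet in this order is the minimal partition: $\pi_1\wedge\pi_2\wedge\cdots\wedge\pi_r=\hat0^B=\{\{1\},\{-1\},\{2\},\{-2\},\ldots,\{n\},\{-n\}\}$. Let $r\ge2$. The number $N^B_{n,r}$ of minimally intersecting $r$-tuples $(\pi_1,\pi_2,\ldots,\pi_r)$ of $B_n$-partitions equals $$N^B_{n,r}=\frac{2^n}{e^{r/2}}\sum_{l_1,l_2,\ldots,l_r\ge0}\frac{(f_r)_n}{(2l_1)!!\,(2l_2)!!\cdots(2l_r)!!},\qquad f_r=\frac12\left(\prod_{t=1}^r(2l_t+1)-1\right),$$ where the multiple series converges absolutely, $(x)_n=x(x-1)\cdots(x-n+1)$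 is the falling factorial (with $(x)_0=1$), and $(2l)!!=2\cdot4\cdots(2l)$ (with $0!!=1$). -/

import Mathlib

open scoped BigOperators Nat Pointwise

/-- The set `[±n] = {±1, ±2, …, ±n}`. -/
noncomputable def signedSet (n : ℕ) : Finset ℤ := (Finset.Icc (-(n : ℤ)) (n : ℤ)).erase 0

/-- A partition of `[±n]` is of type `B_n` if the opposite `-B` of every block `B` is a block and
there is at most one zero-block, that is, a block `B` with `-B = B`. -/
structure IsBPartition {n : ℕ} (P : Finpartition (signedSet n)) : Prop where
  neg_mem : ∀ B ∈ P.parts, -B ∈ P.parts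
  zeroBlock_unique : ∀ B ∈ P.parts, ∀ C ∈ P.parts, -B = B → -C = C → B = C

/-- The `B_n`-partitions. As a subtype of `Finpartition (signedSet n)` it carries the refinement
order: `π ≤ π'` if every block of `π` is contained in some block of `π'`. -/
abbrev BPartition (n : ℕ) : Type := {P : Finpartition (signedSet n) // IsBPartition P}

/-- The partition of `[±n]` into singletons is a `B_n`-partition. -/
theorem isBPartition_bot (n : ℕ) : IsBPartition (⊥ : Finpartition (signedSet n)) where
  neg_mem := by
    intro B hB
    rw [Finpartition.mem_bot_iff] at hB ⊢
    obtain ⟨a, ha, rfl⟩ := hB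
    refine ⟨-a, ?_, by simp⟩
    simp only [signedSet, Finset.mem_erase, Finset.mem_Icc] at ha ⊢
    omega
  zeroBlock_unique := by
    intro B hB C _ hBB _
    rw [Finpartition.mem_bot_iff] at hB
    obtain ⟨a, ha, rfl⟩ := hB
    simp only [signedSet, Finset.mem_erase, Finset.mem_Icc] at ha
    simp only [Finset.neg_singleton, Finset.singleton_inj] at hBB
    omega

/-- The minimal `B_n`-partition `{{1}, {-1}, …, {n}, {-n}}`. -/
noncomputable def minBPartition (n : ℕ) : BPartition n := ⟨⊥, isBPartition_bot n⟩

/-- `π₁, …, π_r` are minimally intersecting if their meet (their greatest lower bound in the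
refinement order on `B_n`-partitions) is the minimal `B_n`-partition. -/
def MinimallyIntersecting {n r : ℕ} (π : Fin r → BPartition n) : Prop :=
  IsGLB (Set.range π) (minBPartition n)

/-- The number `N^B_{n,r}` of minimally intersecting `r`-tuples of `B_n`-partitions. -/
noncomputable def numMinIntersecting (n r : ℕ) : ℕ :=
  Nat.card {π : Fin r → BPartition n // MinimallyIntersecting π}

/-- `f_r = ((2l₁+1)(2l₂+1)⋯(2l_r+1) - 1) / 2`. -/
noncomputable def fParam {r : ℕ} (l : Fin r → ℕ) : ℝ := ((∏ t, (2 * (l t : ℝ) + 1)) - 1) / 2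

/-- The falling factorial `(x)_n = x (x - 1) ⋯ (x - n + 1)`. -/
noncomputable def fallingFactorial (x : ℝ) (n : ℕ) : ℝ := ∏ i ∈ Finset.range n, (x - (i : ℝ))

/-!
Call a map `f` from `[±n]` to an additive group of odd order an odd colouring if
`f (-x) = -f x`. Its colour classes form a `B_n`-partition, the kernel of `f`: opposite elements get
opposite colours, and since `0` is the only colour equal to its opposite, a zero-block can only be
the class of `0`. Let `P` be a `B_n`-partition with `2k` nonzero blocks. The odd colourings with
kernel `P` and values in a group of order `2m + 1` are the equivariant injections of the nonzero
blocks into the nonzero colours, and there are `2 ^ k * (m)_k` of them (`card_odd_isKernel`).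

Colour by `ZMod (2l + 1)`. Whatever `k` is, weighting by `1 / (2l)!!` and summing over `l` gives
`∑ l, 2 ^ k * (l)_k / (2l)!! = exp (1 / 2)` (`hasSum_descFactorial_div_doubleFactorial`), so every
`B_n`-partition gets the same total weight, and every minimally intersecting `r`-tuple gets the
weight `exp (r / 2)`.

On the other hand, fix `l` and let `f t` be odd colourings with values in `ZMod (2 * l t + 1)`. The
kernels of the `f t` are minimally intersecting exactly when the joint colouring
`x ↦ (f t x)_t` is injective (`minimallyIntersecting_iff_injective`). The joint colouring has values
in a group of order `∏ t, (2 * l t + 1) = 2 f_r + 1`, and an injective colouring is one with kernel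
`⊥`, which has `2n` nonzero blocks. So the same count, now with `P = ⊥`, gives
`2 ^ n * (f_r)_n` injective joint colourings. Sorting them by the kernels of their components gives
`two_pow_mul_fallingFactorial_eq_sum`; dividing by `∏ t, (2 * l t)!!` and summing over `l` gives the
theorem. All terms of the sums are nonnegative, which settles convergence.
-/

/-! ### Equivariant injections between free involutions -/

/-- A finite set with a fixed-point-free involution is a set of pairs of opposite elements, that
is, a product with `Bool` on which the involution flips the second coordinate. -/
theorem exists_equiv_prod_bool {P : Type*} [Finite P] {σ : P → P} (hσ : σ.Involutive)
    (hne : ∀ x, σ x ≠ x) :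
    ∃ (T : Type) (_ : Finite T) (e : P ≃ T × Bool), ∀ x, e (σ x) = ((e x).1, !(e x).2) := by
  classical
  obtain ⟨m, ⟨c⟩⟩ := Finite.exists_equiv_fin P
  have key : ∀ x, ¬ c x < c (σ x) → c (σ x) < c x := fun x hx =>
    lt_of_le_of_ne (not_lt.1 hx) fun h => hne x (c.injective h)
  -- From each pair, the element that comes first in the enumeration `c` is the representative.
  refine ⟨{i : Fin m // i < c (σ (c.symm i))}, inferInstance,
    { toFun := fun x => if h : c x < c (σ x) then (⟨c x, by simpa using h⟩, false)
        else (⟨c (σ x), by simpa [hσ x] using key x h⟩, true)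
      invFun := fun t => if t.2 then σ (c.symm t.1) else c.symm t.1
      left_inv := ?_
      right_inv := ?_ }, ?_⟩
  · intro x
    by_cases h : c x < c (σ x) <;> simp [h, hσ x]
  · rintro ⟨⟨i, hi⟩, b⟩
    cases b
    · simp [hi]
    · simp [hσ (c.symm i), not_lt.2 hi.le]
  · intro x
    by_cases h : c x < c (σ x)
    · simp [h, hσ x, not_lt.2 h.le]
    · simp [h, hσ x, key x h]

/-- An equivariant injection between sets of pairs of opposite elements is an injection on pairs
together with a choice of sign for each pair. -/
def equivariantInjectionEquiv (T U : Type*) :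
    {f : T × Bool → U × Bool // f.Injective ∧ ∀ x, f (x.1, !x.2) = ((f x).1, !(f x).2)} ≃
      (T ↪ U) × (T → Bool) where
  toFun f :=
    (⟨fun t => (f.1 (t, false)).1, fun t u h => by
      obtain ⟨f, hf, hodd⟩ := f
      have h2 := hodd (u, false)
      simp only [Bool.not_false] at h2
      by_cases hb : (f (t, false)).2 = (f (u, false)).2
      · exact congrArg Prod.fst (hf (Prod.ext h hb))
      · have : f (t, false) = f (u, true) := by
          rw [h2]
          refine Prod.ext h ?_
          revert hb
          cases (f (t, false)).2 <;> cases (f (u, false)).2 <;> simp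
        exact congrArg Prod.fst (hf this)⟩,
     fun t => (f.1 (t, false)).2)
  invFun g := ⟨fun x => (g.1 x.1, xor x.2 (g.2 x.1)), by
    constructor
    · rintro ⟨t, a⟩ ⟨u, b⟩ h
      obtain ⟨h1, h2⟩ := Prod.ext_iff.1 h
      obtain rfl : t = u := g.1.injective h1
      simpa using h2
    · rintro ⟨t, a⟩
      simp⟩
  left_inv := by
    rintro ⟨f, hf, hodd⟩
    refine Subtype.ext (funext ?_)
    rintro ⟨t, b⟩
    cases b
    · exact Prod.ext rfl (by simp)
    · refine Eq.trans ?_ (hodd (t, false)).symm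
      exact Prod.ext rfl (by simp)
  right_inv := by
    rintro ⟨g, s⟩
    refine Prod.ext (Function.Embedding.ext fun t => ?_) (funext fun t => ?_)
    · rfl
    · simp

theorem even_card_of_involutive {P : Type*} [Finite P] {σ : P → P} (hσ : σ.Involutive)
    (hne : ∀ x, σ x ≠ x) : ∃ k, Nat.card P = 2 * k := by
  obtain ⟨T, _, e, -⟩ := exists_equiv_prod_bool hσ hne
  exact ⟨Nat.card T, by rw [Nat.card_congr e, Nat.card_prod, mul_comm]; simp⟩

theorem card_equivariant_injections {P Q : Type*} [Finite P] [Finite Q] {σ : P → P} {τ : Q → Q}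
    (hσ : σ.Involutive) (hσ' : ∀ x, σ x ≠ x) (hτ : τ.Involutive) (hτ' : ∀ x, τ x ≠ x)
    {k m : ℕ} (hP : Nat.card P = 2 * k) (hQ : Nat.card Q = 2 * m) :
    Nat.card {f : P → Q // f.Injective ∧ ∀ x, f (σ x) = τ (f x)} = 2 ^ k * m.descFactorial k := by
  classical
  obtain ⟨T, _, e, he⟩ := exists_equiv_prod_bool hσ hσ'
  obtain ⟨U, _, d, hd⟩ := exists_equiv_prod_bool hτ hτ'
  have hT : Nat.card T = k := by
    have := Nat.card_congr e
    rw [hP, Nat.card_prod] at this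
    simp at this; omega
  have hU : Nat.card U = m := by
    have := Nat.card_congr d
    rw [hQ, Nat.card_prod] at this
    simp at this; omega
  have he' : ∀ x, σ (e.symm x) = e.symm (x.1, !x.2) := fun x => by
    rw [Equiv.eq_symm_apply, he, e.apply_symm_apply]
  have E : {f : P → Q // f.Injective ∧ ∀ x, f (σ x) = τ (f x)} ≃
      {f : T × Bool → U × Bool // f.Injective ∧ ∀ x, f (x.1, !x.2) = ((f x).1, !(f x).2)} :=
    (Equiv.arrowCongr e d).subtypeEquiv fun f => by
      refine and_congr ?_ ?_
      · simp [Equiv.arrowCongr]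
      · rw [← e.symm.forall_congr_right]
        refine forall_congr' fun x => ?_
        simp [he', ← hd]
  have := Fintype.ofFinite T
  have := Fintype.ofFinite U
  rw [Nat.card_congr (E.trans (equivariantInjectionEquiv T U)), Nat.card_prod, Nat.card_fun,
    Nat.card_eq_fintype_card (α := T ↪ U), Fintype.card_embedding_eq,
    ← Nat.card_eq_fintype_card, ← Nat.card_eq_fintype_card, hT, hU, Nat.card_eq_fintype_card,
    Fintype.card_bool, mul_comm]

/-! ### Odd colourings and their kernels -/

theorem neg_mem_signedSet_iff {n : ℕ} {x : ℤ} : -x ∈ signedSet n ↔ x ∈ signedSet n := by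
  simp only [signedSet, Finset.mem_erase, Finset.mem_Icc]
  omega

instance (n : ℕ) : InvolutiveNeg (signedSet n) where
  neg x := ⟨-x, neg_mem_signedSet_iff.2 x.2⟩
  neg_neg x := Subtype.ext (neg_neg (x : ℤ))

@[simp]
theorem coe_neg_signedSet {n : ℕ} (x : signedSet n) : ((-x : signedSet n) : ℤ) = -x := rfl

theorem ne_zero_of_mem_signedSet {n : ℕ} {x : ℤ} (hx : x ∈ signedSet n) : x ≠ 0 :=
  (Finset.mem_erase.1 hx).1

theorem card_signedSet (n : ℕ) : (signedSet n).card = 2 * n := by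
  rw [signedSet, Finset.card_erase_of_mem (by simp), Int.card_Icc]
  omega

theorem Finpartition.le_iff_forall_mem_part {α : Type*} [DecidableEq α] {s : Finset α}
    {P Q : Finpartition s} : P ≤ Q ↔ ∀ x y, y ∈ P.part x → y ∈ Q.part x := by
  constructor
  · intro h x y hy
    have hx : x ∈ s := P.part_nonempty.1 ⟨y, hy⟩
    obtain ⟨C, hC, hle⟩ := h (P.part_mem.2 hx)
    rw [Q.part_eq_of_mem hC (hle (P.mem_part_self.2 hx))]
    exact hle hy
  · intro h B hB
    obtain ⟨x, hx⟩ := P.nonempty_of_mem_parts hB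
    refine ⟨Q.part x, Q.part_mem.2 (P.le hB hx), fun y hy => h x y ?_⟩
    rwa [P.part_eq_of_mem hB hx]

theorem part_neg {n : ℕ} {P : Finpartition (signedSet n)} (hP : IsBPartition P) (x : ℤ) :
    P.part (-x) = -P.part x := by
  by_cases hx : x ∈ signedSet n
  · exact P.part_eq_of_mem (hP.neg_mem _ (P.part_mem.2 hx)) (by simpa using hx)
  · rw [P.part_eq_empty.2 hx, P.part_eq_empty.2 (mt neg_mem_signedSet_iff.1 hx), Finset.neg_empty]

/-- `P` is the kernel of the colouring `f` of `[±n]`: the blocks of `P` are the nonempty colour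
classes of `f`. -/
def IsKernel {n : ℕ} {G : Type*} (f : signedSet n → G) (P : Finpartition (signedSet n)) : Prop :=
  ∀ x y : signedSet n, f x = f y ↔ (y : ℤ) ∈ P.part x

section Kernel

variable {n : ℕ} {G : Type*} {f : signedSet n → G} {P Q : Finpartition (signedSet n)}

theorem IsKernel.le_iff {H : Type*} {g : signedSet n → H} (hf : IsKernel f P)
    (hg : IsKernel g Q) : P ≤ Q ↔ ∀ x y, f x = f y → g x = g y := by
  rw [Finpartition.le_iff_forall_mem_part]
  constructor
  · intro h x y hxy
    exact (hg x y).2 (h x y ((hf x y).1 hxy))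
  · intro h x y hy
    have hx : x ∈ signedSet n := P.part_nonempty.1 ⟨y, hy⟩
    have hy' : y ∈ signedSet n := P.part_subset x hy
    exact (hg ⟨x, hx⟩ ⟨y, hy'⟩).1 (h _ _ ((hf ⟨x, hx⟩ ⟨y, hy'⟩).2 hy))

theorem IsKernel.unique (hP : IsKernel f P) (hQ : IsKernel f Q) : P = Q :=
  le_antisymm ((hP.le_iff hQ).2 fun _ _ => id) ((hQ.le_iff hP).2 fun _ _ => id)

theorem isKernel_bot_iff : IsKernel f ⊥ ↔ f.Injective := by
  have h : ∀ x y : signedSet n,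
      (y : ℤ) ∈ (⊥ : Finpartition (signedSet n)).part x ↔ x = y := fun x y => by
    rw [Finpartition.part_eq_of_mem (t := {(x : ℤ)}) _
      (Finpartition.mem_bot_iff.2 ⟨x, x.2, rfl⟩) (by simp), Finset.mem_singleton, eq_comm,
      Subtype.ext_iff]
  constructor
  · intro hf x y hxy
    exact (h x y).1 ((hf x y).1 hxy)
  · intro hf x y
    rw [h]
    exact hf.eq_iff

theorem exists_isKernel (f : signedSet n → G) : ∃ P, IsKernel f P := by
  classical
  let F : ℤ → Option G := fun z => if h : z ∈ signedSet n then some (f ⟨z, h⟩) else none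
  refine ⟨Finpartition.ofSetSetoid (Setoid.ker F) (signedSet n), fun x y => ?_⟩
  rw [Finpartition.mem_part_ofSetSetoid_iff_rel, Setoid.ker_def]
  simp [F]

/-- The class of the colour `0` is the only colour class that can be a zero-block. -/
theorem IsKernel.isBPartition [AddGroup G] (hG : ∀ g : G, -g = g → g = 0) (hf : f.Odd)
    (hP : IsKernel f P) : IsBPartition P where
  neg_mem B hB := by
    obtain ⟨x, hx⟩ := P.nonempty_of_mem_parts hB
    have hxs : x ∈ signedSet n := P.le hB hx
    have : P.part (-x) = -B := by
      rw [← P.part_eq_of_mem hB hx]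
      ext y
      rw [Finset.mem_neg']
      by_cases hy : y ∈ signedSet n
      · have h1 := hP (-⟨x, hxs⟩) ⟨y, hy⟩
        have h2 := hP ⟨x, hxs⟩ (-⟨y, hy⟩)
        simp only [coe_neg_signedSet] at h1 h2
        rw [← h1, ← h2, hf, hf, neg_eq_iff_eq_neg]
      · exact iff_of_false (fun h => hy (P.part_subset _ h))
          fun h => hy (neg_mem_signedSet_iff.1 (P.part_subset _ h))
    rw [← this]
    exact P.part_mem.2 (neg_mem_signedSet_iff.2 hxs)
  zeroBlock_unique := by
    have key : ∀ B ∈ P.parts, -B = B → ∃ x : signedSet n, P.part x = B ∧ f x = 0 := by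
      intro B hB hneg
      obtain ⟨x, hx⟩ := P.nonempty_of_mem_parts hB
      have hB' := P.part_eq_of_mem hB hx
      -- `x` and `-x` lie in the same block, so `f x = f (-x) = -f x`.
      refine ⟨⟨x, P.le hB hx⟩, hB', hG _ ?_⟩
      rw [← hf, eq_comm, hP, coe_neg_signedSet]
      rw [hB', ← Finset.mem_neg', hneg]
      exact hx
    intro B hB C hC hB' hC'
    obtain ⟨x, rfl, hx⟩ := key B hB hB'
    obtain ⟨y, rfl, hy⟩ := key C hC hC'
    exact (P.mem_part_iff_part_eq_part x.2 y.2).1 ((hP y x).1 (hy.trans hx.symm))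

end Kernel

/-- The blocks `B` of `P` with `-B ≠ B`. -/
abbrev NonzeroBlock {n : ℕ} (P : Finpartition (signedSet n)) : Type :=
  {B : Finset ℤ // B ∈ P.parts ∧ -B ≠ B}

instance {n : ℕ} (P : Finpartition (signedSet n)) : Finite (NonzeroBlock P) :=
  Finite.of_injective (fun B => (⟨B.1, B.2.1⟩ : P.parts)) fun _ _ h =>
    Subtype.ext (congrArg (fun C : P.parts => C.1) h)

/-- The involution `B ↦ -B` on the nonzero blocks. -/
def NonzeroBlock.neg {n : ℕ} {P : Finpartition (signedSet n)} (hP : IsBPartition P)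
    (B : NonzeroBlock P) : NonzeroBlock P :=
  ⟨-B.1, hP.neg_mem _ B.2.1, by simpa [eq_comm] using B.2.2⟩

theorem NonzeroBlock.neg_involutive {n : ℕ} {P : Finpartition (signedSet n)}
    (hP : IsBPartition P) : (NonzeroBlock.neg hP).Involutive :=
  fun B => Subtype.ext (neg_neg B.1)

theorem NonzeroBlock.neg_ne {n : ℕ} {P : Finpartition (signedSet n)} (hP : IsBPartition P)
    (B : NonzeroBlock P) : NonzeroBlock.neg hP B ≠ B :=
  fun h => B.2.2 (congrArg Subtype.val h)

theorem card_nonzeroBlock_bot (n : ℕ) :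
    Nat.card (NonzeroBlock (⊥ : Finpartition (signedSet n))) = 2 * n := by
  rw [← card_signedSet, ← Fintype.card_coe, ← Nat.card_eq_fintype_card]
  symm
  refine Nat.card_eq_of_bijective (fun x : signedSet n =>
    ⟨{(x : ℤ)}, Finpartition.mem_bot_iff.2 ⟨x, x.2, rfl⟩, ?_⟩) ⟨?_, ?_⟩
  · have := ne_zero_of_mem_signedSet x.2
    rw [Finset.neg_singleton, Ne, Finset.singleton_inj]
    omega
  · intro x y h
    exact Subtype.ext (Finset.singleton_injective (congrArg Subtype.val h))
  · rintro ⟨B, hB, -⟩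
    obtain ⟨x, hx, rfl⟩ := Finpartition.mem_bot_iff.1 hB
    exact ⟨⟨x, hx⟩, rfl⟩

/-- An odd colouring with kernel `P` is `0` on the zero-block, and it is given by an injective
and equivariant choice of nonzero colours for the other blocks. -/
theorem card_odd_isKernel {n : ℕ} {G : Type*} [AddGroup G] [Finite G]
    (hG : ∀ g : G, -g = g → g = 0) {P : Finpartition (signedSet n)} (hP : IsBPartition P)
    {k m : ℕ} (hk : Nat.card (NonzeroBlock P) = 2 * k) (hm : Nat.card G = 2 * m + 1) :
    Nat.card {f : signedSet n → G // f.Odd ∧ IsKernel f P} = 2 ^ k * m.descFactorial k := by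
  classical
  have hτ : (fun g : {g : G // g ≠ 0} =>
      (⟨-g.1, neg_ne_zero.2 g.2⟩ : {g : G // g ≠ 0})).Involutive :=
    fun g => Subtype.ext (neg_neg g.1)
  have hQ : Nat.card {g : G // g ≠ 0} = 2 * m := by
    have := Fintype.ofFinite G
    rw [Nat.card_eq_fintype_card] at hm ⊢
    rw [Fintype.card_subtype_compl, hm]
    simp
  rw [← card_equivariant_injections (NonzeroBlock.neg_involutive hP) (NonzeroBlock.neg_ne hP) hτ
    (fun g h => g.2 (hG _ (congrArg Subtype.val h))) hk hQ]
  symm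
  -- `F h` gives a nonzero block `B` the colour `h B` and the zero-block the colour `0`.
  let F (h : NonzeroBlock P → {g : G // g ≠ 0}) (x : signedSet n) : G :=
    if hx : -P.part x = P.part x then 0 else (h ⟨P.part x, P.part_mem.2 x.2, hx⟩ : G)
  have F_zero : ∀ h (x : signedSet n), -P.part x = P.part x → F h x = 0 := fun h x hx => dif_pos hx
  have F_block : ∀ h (B : NonzeroBlock P) (x : signedSet n), P.part x = B.1 → F h x = h B := by
    rintro h ⟨B, hB, hneg⟩ x rfl
    exact dif_neg hneg
  have exists_rep : ∀ B : NonzeroBlock P, ∃ x : signedSet n, P.part x = B.1 := fun B => by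
    obtain ⟨x, hx⟩ := P.nonempty_of_mem_parts B.2.1
    exact ⟨⟨x, P.le B.2.1 hx⟩, P.part_eq_of_mem B.2.1 hx⟩
  have block : ∀ x : signedSet n, -P.part x ≠ P.part x → ∃ B : NonzeroBlock P, P.part x = B.1 :=
    fun x hx => ⟨⟨P.part x, P.part_mem.2 x.2, hx⟩, rfl⟩
  refine Nat.card_eq_of_bijective (fun h => ⟨F h.1, ?_, ?_⟩) ⟨?_, ?_⟩
  · intro x
    by_cases hx : -P.part x = P.part x
    · rw [F_zero _ x hx, F_zero _ (-x) (by simp [part_neg hP, hx]), neg_zero]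
    · obtain ⟨B, hB⟩ := block x hx
      rw [F_block _ B x hB, F_block _ (NonzeroBlock.neg hP B) (-x) (by
        rw [coe_neg_signedSet, part_neg hP, hB]; rfl), h.2.2]
  · intro x y
    rw [P.mem_part_iff_part_eq_part y.2 x.2]
    by_cases hx : -P.part x = P.part x <;> by_cases hy : -P.part y = P.part y
    · rw [F_zero _ x hx, F_zero _ y hy]
      exact iff_of_true rfl
        (hP.zeroBlock_unique _ (P.part_mem.2 y.2) _ (P.part_mem.2 x.2) hy hx)
    · obtain ⟨B, hB⟩ := block y hy
      rw [F_zero _ x hx, F_block _ B y hB]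
      exact iff_of_false (h.1 B).2.symm fun e => hy (by rw [e, hx])
    · obtain ⟨B, hB⟩ := block x hx
      rw [F_zero _ y hy, F_block _ B x hB]
      exact iff_of_false (h.1 B).2 fun e => hx (by rw [← e, hy])
    · obtain ⟨B, hB⟩ := block x hx
      obtain ⟨C, hC⟩ := block y hy
      rw [F_block _ B x hB, F_block _ C y hC, hB, hC, ← Subtype.ext_iff, h.2.1.eq_iff,
        ← Subtype.ext_iff, eq_comm]
  · intro h h' e
    refine Subtype.ext (funext fun B => Subtype.ext ?_)
    obtain ⟨x, hx⟩ := exists_rep B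
    rw [← F_block h.1 B x hx, ← F_block h'.1 B x hx]
    exact congrFun (congrArg Subtype.val e) x
  · rintro ⟨f, hodd, hf⟩
    choose rep hrep using exists_rep
    have f_eq : ∀ x y : signedSet n, f x = f y ↔ P.part x = P.part y := fun x y => by
      rw [hf, P.mem_part_iff_part_eq_part y.2 x.2, eq_comm]
    have f_zero : ∀ x : signedSet n, f x = 0 ↔ -P.part x = P.part x := fun x => by
      rw [← part_neg hP, ← coe_neg_signedSet, ← f_eq, hodd]
      exact ⟨fun h => by rw [h, neg_zero], hG _⟩
    refine ⟨⟨fun B => ⟨f (rep B), fun h => B.2.2 ?_⟩, ?_, ?_⟩, ?_⟩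
    · rw [← hrep B, (f_zero _).1 h]
    · intro B C h
      have := (f_eq _ _).1 (congrArg Subtype.val h)
      rw [hrep, hrep] at this
      exact Subtype.ext this
    · intro B
      refine Subtype.ext ?_
      change f (rep (NonzeroBlock.neg hP B)) = -f (rep B)
      rw [← hodd, f_eq, hrep, coe_neg_signedSet, part_neg hP, hrep]
      rfl
    · refine Subtype.ext (funext fun x => ?_)
      by_cases hx : -P.part x = P.part x
      · exact (F_zero _ x hx).trans ((f_zero x).2 hx).symm
      · obtain ⟨B, hB⟩ := block x hx
        refine (F_block _ B x hB).trans ?_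
        exact (f_eq _ _).2 (by rw [hrep, hB])

/-! ### Tuples of odd colourings -/

section Tuples

variable {n r : ℕ} {G : Fin r → Type*} [∀ t, AddGroup (G t)]

theorem minimallyIntersecting_iff_injective (hG : ∀ t, ∀ g : G t, -g = g → g = 0)
    {π : Fin r → BPartition n} {f : ∀ t, signedSet n → G t} (hodd : ∀ t, (f t).Odd)
    (hf : ∀ t, IsKernel (f t) (π t).1) :
    MinimallyIntersecting π ↔ (fun x t => f t x : signedSet n → ∀ t, G t).Injective := by
  have hG' : ∀ g : ∀ t, G t, -g = g → g = 0 := fun g h => funext fun t => hG t _ (congrFun h t)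
  obtain ⟨P, hP⟩ := exists_isKernel (fun x t => f t x : signedSet n → ∀ t, G t)
  have hPB : IsBPartition P := hP.isBPartition hG' fun x => funext fun t => hodd t x
  rw [← isKernel_bot_iff]
  constructor
  · intro h
    -- The kernel of the joint colouring is a lower bound of the `π t`.
    have hle : (⟨P, hPB⟩ : BPartition n) ≤ minBPartition n := by
      refine h.2 ?_
      rintro _ ⟨t, rfl⟩
      exact (hP.le_iff (hf t)).2 fun x y e => congrFun e t
    rwa [← show P = ⊥ from le_bot_iff.1 hle]
  · intro h
    refine ⟨fun _ _ => (bot_le : (⊥ : Finpartition (signedSet n)) ≤ _), fun σ hσ => ?_⟩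
    obtain ⟨σ, hσB⟩ := σ
    refine Finpartition.le_iff_forall_mem_part.2 fun x y hy => ?_
    have hx : x ∈ signedSet n := σ.part_nonempty.1 ⟨y, hy⟩
    have hy' : y ∈ signedSet n := σ.part_subset x hy
    refine (h ⟨x, hx⟩ ⟨y, hy'⟩).1 (funext fun t => (hf t _ _).2 ?_)
    exact Finpartition.le_iff_forall_mem_part.1 (hσ ⟨t, rfl⟩) x y hy

instance (n : ℕ) : Finite (BPartition n) := Subtype.finite

noncomputable instance (n r : ℕ) :
    Fintype {π : Fin r → BPartition n // MinimallyIntersecting π} := Fintype.ofFinite _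

/-- Injective odd colourings by tuples, sorted by the kernels of their components. -/
theorem card_odd_isKernel_bot_pi [∀ t, Finite (G t)]
    (hG : ∀ t, ∀ g : G t, -g = g → g = 0) :
    Nat.card {F : signedSet n → ∀ t, G t // F.Odd ∧ IsKernel F ⊥} =
      ∑ π : {π : Fin r → BPartition n // MinimallyIntersecting π},
        ∏ t, Nat.card {f : signedSet n → G t // f.Odd ∧ IsKernel f (π.1 t).1} := by
  simp_rw [← Nat.card_pi]
  rw [← Nat.card_sigma]
  symm
  refine Nat.card_eq_of_bijective (fun p => ⟨fun x t => (p.2 t).1 x, fun x =>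
    funext fun t => (p.2 t).2.1 x, isKernel_bot_iff.2 ((minimallyIntersecting_iff_injective hG
      (fun t => (p.2 t).2.1) (fun t => (p.2 t).2.2)).1 p.1.2)⟩) ⟨?_, ?_⟩
  · rintro ⟨⟨π, hπ⟩, f⟩ ⟨⟨π', hπ'⟩, f'⟩ h
    have hff : ∀ t, (f t).1 = (f' t).1 := fun t => funext fun x =>
      congrFun (congrFun (congrArg Subtype.val h) x) t
    obtain rfl : π = π' := funext fun t => Subtype.ext <| by
      have := (f' t).2.2
      rw [← hff t] at this
      exact (f t).2.2.unique this
    obtain rfl : f = f' := funext fun t => Subtype.ext (hff t)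
    rfl
  · rintro ⟨F, hodd, hF⟩
    have hodd' : ∀ t, (fun x => F x t).Odd := fun t x => congrFun (hodd x) t
    choose P hP using fun t => exists_isKernel (fun x => F x t)
    refine ⟨⟨⟨fun t => ⟨P t, (hP t).isBPartition (hG t) (hodd' t)⟩, ?_⟩,
      fun t => ⟨fun x => F x t, hodd' t, hP t⟩⟩, rfl⟩
    exact (minimallyIntersecting_iff_injective hG hodd' hP).2 (isKernel_bot_iff.1 hF)

end Tuples

/-! ### The series -/

/-- Since `(2l)‼ = 2 ^ l * l!`, the weights `1 / (2l)‼` are those of the Poisson distribution with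
mean `1 / 2` up to the factor `exp (1 / 2)`, and its `k`-th factorial moment is `2⁻ᵏ`. -/
theorem hasSum_descFactorial_div_doubleFactorial (k : ℕ) :
    HasSum (fun l : ℕ => ((2 ^ k * l.descFactorial k : ℕ) : ℝ) / ((2 * l)‼ : ℕ))
      (Real.exp (1 / 2)) := by
  have h0 : ∀ l ∉ Set.range (· + k),
      ((2 ^ k * l.descFactorial k : ℕ) : ℝ) / ((2 * l)‼ : ℕ) = 0 := by
    intro l hl
    have : l < k := by
      by_contra h
      exact hl ⟨l - k, Nat.sub_add_cancel (not_lt.1 h)⟩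
    simp [Nat.descFactorial_of_lt this]
  rw [← (add_left_injective k).hasSum_iff h0, Real.exp_eq_exp_ℝ]
  convert! NormedSpace.expSeries_div_hasSum_exp (1 / 2 : ℝ) using 1
  funext l
  have h := Nat.factorial_mul_descFactorial (Nat.le_add_left k l)
  rw [Nat.add_sub_cancel] at h
  have h1 : (l ! : ℝ) ≠ 0 := by positivity
  have h2 : ((l + k)! : ℝ) ≠ 0 := by positivity
  simp only [Function.comp_apply, Nat.doubleFactorial_two_mul]
  rw [← h] at h2 ⊢
  push_cast at h2 ⊢
  rw [one_div, inv_pow]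
  field_simp
  ring

/-- A product of convergent series of nonnegative terms is a convergent multiple series. -/
theorem hasSum_pi_prod_of_nonneg {r : ℕ} {g : Fin r → ℕ → ℝ} {a : Fin r → ℝ}
    (h0 : ∀ t l, 0 ≤ g t l) (hg : ∀ t, HasSum (g t) (a t)) :
    HasSum (fun l : Fin r → ℕ => ∏ t, g t (l t)) (∏ t, a t) := by
  induction r with
  | zero => simp
  | succ r ih =>
    let p : (Fin r → ℕ) → ℝ := fun l => ∏ t, g t.succ (l t)
    have h1 : HasSum p (∏ t : Fin r, a t.succ) :=
      ih (g := fun t => g t.succ) (fun t => h0 t.succ) fun t => hg t.succ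
    have hp0 : 0 ≤ p := fun l => Finset.prod_nonneg fun t _ => h0 t.succ (l t)
    have hg0 : 0 ≤ g 0 := fun l => h0 0 l
    have h2 := (hg 0).mul h1 ((hg 0).summable.mul_of_nonneg h1.summable hg0 hp0)
    let e : ℕ × (Fin r → ℕ) ≃ (Fin (r + 1) → ℕ) := Fin.consEquiv fun _ => ℕ
    rw [Fin.prod_univ_succ]
    refine e.hasSum_iff.1 ?_
    convert! h2 using 2 with x
    simp [e, p, Fin.prod_univ_succ, Fin.consEquiv]

/-- At `fParam l`, which is a natural number because the product of odd numbers is odd, the real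
falling factorial is `Nat.descFactorial`. In particular it vanishes when `fParam l < n`. -/
theorem two_pow_mul_fallingFactorial_fParam {r m : ℕ} {l : Fin r → ℕ}
    (hm : ∏ t, (2 * l t + 1) = 2 * m + 1) (n : ℕ) :
    2 ^ n * fallingFactorial (fParam l) n = ((2 ^ n * m.descFactorial n : ℕ) : ℝ) := by
  have h : fParam l = m := by
    have : ∏ t, (2 * (l t : ℝ) + 1) = 2 * m + 1 := by exact_mod_cast hm
    rw [fParam, this]
    ring
  rw [h, fallingFactorial, ← descPochhammer_eval_eq_prod_range,
    descPochhammer_eval_eq_descFactorial]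
  push_cast
  rfl

/-- Both sides count the injective odd colourings of `[±n]` by `∏ t, ZMod (2 * l t + 1)`. Here `k P`
is half the number of nonzero blocks of `P`. -/
theorem two_pow_mul_fallingFactorial_eq_sum {n r : ℕ}
    {k : BPartition n → ℕ} (hk : ∀ P, Nat.card (NonzeroBlock P.1) = 2 * k P) (l : Fin r → ℕ) :
    2 ^ n * fallingFactorial (fParam l) n =
      ∑ π : {π : Fin r → BPartition n // MinimallyIntersecting π},
        ∏ t, ((2 ^ k (π.1 t) * (l t).descFactorial (k (π.1 t)) : ℕ) : ℝ) := by
  have hG : ∀ t, ∀ g : ZMod (2 * l t + 1), -g = g → g = 0 := fun t g h => by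
    by_contra h0
    exact ZMod.ne_neg_self ⟨l t, rfl⟩ h0 h.symm
  have hodd : Odd (∏ t, (2 * l t + 1)) :=
    Finset.prod_induction _ Odd (fun _ _ => Odd.mul) odd_one fun t _ => ⟨l t, rfl⟩
  obtain ⟨m, hm⟩ := hodd
  have h := card_odd_isKernel_bot_pi (n := n) hG
  rw [card_odd_isKernel (fun g h => funext fun t => hG t _ (congrFun h t)) (isBPartition_bot n)
    (card_nonzeroBlock_bot n) (m := m) (by simp [hm])] at h
  rw [two_pow_mul_fallingFactorial_fParam hm, h]
  push_cast
  refine Finset.sum_congr rfl fun π _ => Finset.prod_congr rfl fun t _ => ?_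
  rw [card_odd_isKernel (hG t) (π.1 t).2 (hk _) (m := l t) (by simp)]
  push_cast
  rfl

theorem mainTheorem1 (n r : ℕ) (hr : 2 ≤ r) :
    Summable (fun l : Fin r → ℕ =>
      fallingFactorial (fParam l) n / ∏ t, (((2 * l t)‼ : ℕ) : ℝ)) ∧
    (numMinIntersecting n r : ℝ) =
      2 ^ n / Real.exp ((r : ℝ) / 2) *
        ∑' l : Fin r → ℕ, fallingFactorial (fParam l) n / ∏ t, (((2 * l t)‼ : ℕ) : ℝ) := by
  choose k hk using fun P : BPartition n =>
    even_card_of_involutive (NonzeroBlock.neg_involutive P.2) (NonzeroBlock.neg_ne P.2)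
  have hsum : HasSum (fun l : Fin r → ℕ =>
      2 ^ n * (fallingFactorial (fParam l) n / ∏ t, (((2 * l t)‼ : ℕ) : ℝ)))
      (∑ _π : {π : Fin r → BPartition n // MinimallyIntersecting π},
        ∏ _t : Fin r, Real.exp (1 / 2)) := by
    simp_rw [← mul_div_assoc, two_pow_mul_fallingFactorial_eq_sum hk, Finset.sum_div,
      ← Finset.prod_div_distrib]
    refine hasSum_sum fun π _ => ?_
    exact hasSum_pi_prod_of_nonneg
      (g := fun t l => ((2 ^ k (π.1 t) * l.descFactorial (k (π.1 t)) : ℕ) : ℝ) / ((2 * l)‼ : ℕ))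
      (fun t l => div_nonneg (Nat.cast_nonneg _) (Nat.cast_nonneg _))
      fun t => hasSum_descFactorial_div_doubleFactorial (k (π.1 t))
  have h2 : (2 ^ n : ℝ) ≠ 0 := by positivity
  refine ⟨(summable_mul_left_iff h2).1 hsum.summable, ?_⟩
  have h := hsum.tsum_eq
  rw [tsum_mul_left, Finset.prod_const, Finset.card_univ, Fintype.card_fin, ← Real.exp_nat_mul,
    Finset.sum_const, Finset.card_univ, ← Nat.card_eq_fintype_card, nsmul_eq_mul, mul_one_div] at h
  rw [div_mul_eq_mul_div, h, mul_div_cancel_right₀ _ (Real.exp_ne_zero _), numMinIntersecting]
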